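/- Let $M$ be a smooth ($C^\infty$) $2$-dimensional manifold, let $P\in M$ and $N\ge 2$, and let $f$ be a function on $T^*M$. For local coordinates $(x^1,x^2)$ on an open subset of $M$, let $(x^1,x^2,p_1,p_2)$ denote the induced coordinates of $T^*M$, so that a covector is written $p_1\,dx^1+p_2\,dx^2$. Suppose that in some smooth local coordinates $(x^1,x^2)$ defined around $P$ the function $f$ is a homogeneous polynomial of degree $N$ in the momenta that is a product of $N$ real linear factors, $$f=\prod_{m=1}^{N}(\alpha_m^1p_1+\alpha_m^2p_2),\qquad \alpha_m^k=\alpha_m^k(x^1,x^2)\ \text{smooth},$$ and that two of these factors, which after renumbering are the first two, are linearly independent at $P$; that is, $$f=(\alpha_1^1p_1+\alpha_1^2p_2)(\alpha_2^1p_1+\alpha_2^2p_2)\,Q,\qquad Q=\prod_{m=3}^{N}(\alpha_m^1p_1+\alpha_m^2p_2),\qquad \alpha_1^1(P)\alpha_2^2(P)-\alpha_2^1(P)\alpha_1^2(P)\neq 0 .$$ Then on some neighborhood $U$ of $P$ there are smooth coordinates $(x^1_{\rm new},x^2_{\rm new})$ such that, in the induced coordinates $(x^1_{\rm new},x^2_{\rm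 new},p_1,p_2)$ of $T^*U$: * if $N\ge 3$, then $$f=p_1p_2\prod_{i=1}^{N-2}(\beta_i^1p_1+\beta_i^2p_2)$$ with smooth functions $\beta_i^k=\beta_i^k(x^1_{\rm new},x^2_{\rm new})$; * if $N=2$, then $f=c\,p_1p_2$ with a smooth nowhere vanishing function $c=c(x^1_{\rm new},x^2_{\rm new})$. -/

import Mathlib

open scoped Manifold ContDiff

noncomputable section

/-- The coordinate plane, with points `(x 0, x 1)` standing for `(x¹, x²)`. -/
abbrev Plane : Type := EuclideanSpace ℝ (Fin 2)

/-- The cotangent space of a smooth surface `M` at `x`: the dual of the tangent space. -/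
abbrev CotangentAt {M : Type*} [TopologicalSpace M] [ChartedSpace Plane M] (x : M) : Type :=
  TangentSpace (𝓡 2) x →L[ℝ] ℝ

/-- The covector `p₁ dx¹ + p₂ dx²` at `x`, where `(x¹, x²)` are the coordinates given by `φ`.
On `φ.source` the pair `(φ x, p)` is thus the system of coordinates of the covector in the
coordinate system of the cotangent bundle that is induced by `φ`. -/
def covectorOfMomenta {M : Type*} [TopologicalSpace M] [ChartedSpace Plane M]
    (φ : OpenPartialHomeomorph M Plane) (x : M) (p : Fin 2 → ℝ) : CotangentAt x :=
  (∑ i : Fin 2, p i • (EuclideanSpace.proj i : Plane →L[ℝ] ℝ)).comp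
    (mfderiv (𝓡 2) (𝓡 2) φ x : TangentSpace (𝓡 2) x →L[ℝ] Plane)

/-- Over `φ.source`, the function `f` on the cotangent bundle has the expression
`F (x¹, x²) (p₁, p₂)` in the coordinates induced by `φ`. -/
def HasExpression {M : Type*} [TopologicalSpace M] [ChartedSpace Plane M]
    (f : (x : M) → CotangentAt x → ℝ) (φ : OpenPartialHomeomorph M Plane)
    (F : Plane → (Fin 2 → ℝ) → ℝ) : Prop :=
  ∀ x ∈ φ.source, ∀ p : Fin 2 → ℝ, f x (covectorOfMomenta φ x p) = F (φ x) p

end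

/-!
Near `P` the two independent linear factors of `f` are the symbols of two vector fields `V₁`, `V₂`
that span the plane. If `u₁` and `u₂` are functions with `V₂ u₁ = 0`, `V₁ u₂ = 0` and nonzero
differentials, then `(u₁, u₂)` is a coordinate system (`exists_adapted_coordinates`) in which
`V₁` is a multiple of the first coordinate field and `V₂` of the second. The symbol of a field is
linear in the momenta with the components of the field as coefficients, and this persists in every
coordinate system (`covectorOfMomenta_trans`), so the two factors become nonvanishing multiples
of `p₁` and `p₂`, and the other factors stay linear.

The analytic content is the existence of smooth first integrals of a nonvanishing planar field
(`exists_first_integral`). In suitable linear coordinates the integral curves are graphs of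
solutions of a scalar equation `y' = g(t, y)`, and it has to be shown that its flow `Φ(t, y)` is
smooth (`exists_contDiff_flow`). In the scalar case this is elementary: the difference of two
solutions solves a linear equation, so it is an explicit exponential, which gives
`∂Φ/∂y = exp (∫₀ᵗ ∂g/∂y (s, Φ(s, y)) ds)`. Together with `∂Φ/∂t = g(t, Φ)` this expresses both
partial derivatives through `Φ`, and every degree of smoothness of `Φ` implies the next one.
-/

/-! ### Smoothness of functions of two real variables -/

/-- A function of two real variables with `C^n` partial derivatives is of class `C^(n+1)`. -/
theorem contDiff_succ_of_hasDerivAt_partials {n : ℕ} {F F₁ F₂ : ℝ × ℝ → ℝ}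
    (h₁ : ∀ p : ℝ × ℝ, HasDerivAt (fun s => F (s, p.2)) (F₁ p) p.1)
    (h₂ : ∀ p : ℝ × ℝ, HasDerivAt (fun y => F (p.1, y)) (F₂ p) p.2)
    (hF₁ : ContDiff ℝ n F₁) (hF₂ : ContDiff ℝ n F₂) : ContDiff ℝ (n + 1) F := by
  rw [contDiff_succ_iff_hasFDerivAt]
  refine ⟨fun p => F₁ p • ContinuousLinearMap.fst ℝ ℝ ℝ + F₂ p • ContinuousLinearMap.snd ℝ ℝ ℝ,
    (hF₁.smul contDiff_const).add (hF₂.smul contDiff_const), fun p => ?_⟩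
  have key := hasStrictFDerivAt_uncurry_coprod (𝕜 := ℝ) (u := p) (f := fun a b => F (a, b))
    (f₁ := fun a b => ContinuousLinearMap.toSpanSingleton ℝ (F₁ (a, b)))
    (f₂ := fun a b => ContinuousLinearMap.toSpanSingleton ℝ (F₂ (a, b)))
    (Filter.Eventually.of_forall fun v => (h₁ v).hasFDerivAt)
    (Filter.Eventually.of_forall fun v => (h₂ v).hasFDerivAt)
    (((ContinuousLinearMap.toSpanSingletonCLE (𝕜 := ℝ) (E := ℝ)).continuous.comp
      hF₁.continuous).continuousAt)
    (((ContinuousLinearMap.toSpanSingletonCLE (𝕜 := ℝ) (E := ℝ)).continuous.comp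
      hF₂.continuous).continuousAt)
  refine key.hasFDerivAt.congr_fderiv ?_
  ext <;> simp [Function.HasUncurry.uncurry]

theorem hasDerivAt_intervalIntegral_param {h h₂ : ℝ × ℝ → ℝ} (hh : Continuous h)
    (hh₂ : Continuous h₂) (hd : ∀ p : ℝ × ℝ, HasDerivAt (fun y => h (p.1, y)) (h₂ p) p.2)
    (t y : ℝ) :
    HasDerivAt (fun y => ∫ s in (0 : ℝ)..t, h (s, y)) (∫ s in (0 : ℝ)..t, h₂ (s, y)) y := by
  obtain ⟨C, hC⟩ := ((isCompact_uIcc (a := (0 : ℝ)) (b := t)).prod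
    (isCompact_closedBall y 1)).exists_bound_of_continuousOn hh₂.continuousOn
  refine (intervalIntegral.hasDerivAt_integral_of_dominated_loc_of_deriv_le
    (F := fun y s => h (s, y)) (F' := fun y s => h₂ (s, y)) (bound := fun _ => C)
    (Metric.closedBall_mem_nhds y one_pos) ?_ ?_ ?_ ?_ ?_ ?_).2
  · exact .of_forall fun z => (by fun_prop : Continuous fun s => h (s, z)).aestronglyMeasurable
  · exact (by fun_prop : Continuous fun s => h (s, y)).intervalIntegrable _ _
  · exact (by fun_prop : Continuous fun s => h₂ (s, y)).aestronglyMeasurable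
  · exact .of_forall fun s hs z hz => hC (s, z) ⟨Set.uIoc_subset_uIcc hs, hz⟩
  · exact intervalIntegrable_const
  · exact .of_forall fun s _ z _ => hd (s, z)

/-- A function of two real variables of class `C^(n+1)` has a vertical derivative of class `C^n`. -/
theorem ContDiff.exists_hasDerivAt_snd {n m : WithTop ℕ∞} {h : ℝ × ℝ → ℝ} (hh : ContDiff ℝ n h)
    (hmn : m + 1 ≤ n) : ∃ h₂ : ℝ × ℝ → ℝ, ContDiff ℝ m h₂ ∧
      ∀ p : ℝ × ℝ, HasDerivAt (fun y => h (p.1, y)) (h₂ p) p.2 := by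
  refine ⟨fun p => fderiv ℝ h p (0, 1), (hh.fderiv_right hmn).clm_apply contDiff_const,
    fun p => ?_⟩
  have h1 : HasFDerivAt h (fderiv ℝ h p) p :=
    (hh.differentiable (by rintro rfl; simp at hmn)).differentiableAt.hasFDerivAt
  have h2 : HasDerivAt (fun y : ℝ => (p.1, y)) ((0 : ℝ), (1 : ℝ)) p.2 :=
    (hasDerivAt_const _ _).prodMk (hasDerivAt_id _)
  exact h1.comp_hasDerivAt_of_eq p.2 h2 rfl

theorem ContDiff.intervalIntegral_fst {n : ℕ} {h : ℝ × ℝ → ℝ} (hh : ContDiff ℝ n h) :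
    ContDiff ℝ n fun p : ℝ × ℝ => ∫ s in (0 : ℝ)..p.1, h (s, p.2) := by
  have cont {h : ℝ × ℝ → ℝ} (hh : Continuous h) :
      Continuous fun p : ℝ × ℝ => ∫ s in (0 : ℝ)..p.1, h (s, p.2) :=
    intervalIntegral.continuous_parametric_intervalIntegral_of_continuous
      (f := fun p : ℝ × ℝ => fun s => h (s, p.2)) (by fun_prop) continuous_fst
  induction n generalizing h with
  | zero => exact contDiff_zero.2 (cont (contDiff_zero.1 hh))
  | succ n ih =>
    obtain ⟨h₂, hh₂, hd⟩ := hh.exists_hasDerivAt_snd (m := n) (by norm_cast)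
    refine contDiff_succ_of_hasDerivAt_partials (F₁ := h) (fun p => ?_)
      (fun p => hasDerivAt_intervalIntegral_param hh.continuous hh₂.continuous hd p.1 p.2)
      (hh.of_le (by norm_cast; omega)) (ih hh₂)
    have hc : Continuous fun s => h (s, p.2) := by have := hh.continuous; fun_prop
    exact (hc.integral_hasStrictDerivAt 0 p.1).hasDerivAt

/-! ### The flow of a scalar differential equation -/

/-- Global existence for a bounded right-hand side that is Lipschitz in the space variable. -/
theorem exists_global_solution {g : ℝ × ℝ → ℝ} (hg : Continuous g) {K L : NNReal}
    (hK : ∀ t, LipschitzWith K fun y => g (t, y)) (hL : ∀ p, ‖g p‖ ≤ L) (y : ℝ) :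
    ∃ γ : ℝ → ℝ, γ 0 = y ∧ ∀ t, HasDerivAt γ (g (t, γ t)) t := by
  have loc (T : ℝ) : ∃ γ : ℝ → ℝ, 0 < T → γ 0 = y ∧
      ∀ t ∈ Set.Ioo (-T) T, HasDerivAt γ (g (t, γ t)) t := by
    by_cases hT : 0 < T
    -- The bounds on `g` are global, so the ball may be as large as the time interval requires.
    · have hpl : IsPicardLindelof (fun t y => g (t, y)) (tmin := -T) (tmax := T)
          ⟨0, by constructor <;> linarith⟩ y (L * T.toNNReal) 0 L K :=
        { lipschitzOnWith := fun t _ => (hK t).lipschitzOnWith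
          continuousOn := fun x _ => by fun_prop
          norm_le := fun t _ x _ => hL _
          mul_max_le := by simp [hT.le] }
      obtain ⟨γ, h0, h⟩ := hpl.exists_eq_forall_mem_Icc_hasDerivWithinAt₀
      exact ⟨γ, fun _ => ⟨h0, fun t ht =>
        (h t ⟨ht.1.le, ht.2.le⟩).hasDerivAt (Icc_mem_nhds ht.1 ht.2)⟩⟩
    · exact ⟨0, fun h => absurd h hT⟩
  choose γ hγ using loc
  -- By uniqueness, solutions on longer and longer intervals extend one another.
  have glue {S T : ℝ} (hS : 0 < S) (hST : S ≤ T) : Set.EqOn (γ S) (γ T) (Set.Ioo (-S) S) :=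
    ODE_solution_unique_of_mem_Ioo (v := fun t y => g (t, y)) (s := fun _ => Set.univ) (t₀ := 0)
      (fun t _ => (hK t).lipschitzOnWith) (by constructor <;> linarith)
      (fun t ht => ⟨(hγ S hS).2 t ht, trivial⟩)
      (fun t ht => ⟨(hγ T (hS.trans_le hST)).2 t ⟨by linarith [ht.1], by linarith [ht.2]⟩, trivial⟩)
      ((hγ S hS).1.trans (hγ T (hS.trans_le hST)).1.symm)
  refine ⟨fun t => γ (|t| + 1) t, (hγ _ (by positivity)).1, fun t => ?_⟩
  have hd := (hγ (|t| + 2) (by positivity)).2 t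
    ⟨by linarith [neg_abs_le t], by linarith [le_abs_self t]⟩
  have heq : ∀ s : ℝ, |s| < |t| + 1 → γ (|s| + 1) s = γ (|t| + 2) s := fun s hs =>
    glue (by positivity) (by linarith) (abs_lt.1 (by linarith))
  rw [← heq t (by linarith)] at hd
  refine hd.congr_of_eventuallyEq ?_
  filter_upwards [(continuous_abs.tendsto t).eventually (gt_mem_nhds (by linarith : |t| < |t| + 1))]
    with s hs using heq s hs

/-- The difference of two solutions of `y' = g(t, y)` solves a linear equation, so it is an
exponential; `G` is the difference quotient of `g` in the second variable. -/
theorem solution_sub_eq_mul_exp {g : ℝ × ℝ → ℝ} {G : ℝ × ℝ × ℝ → ℝ} (hG : Continuous G)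
    (hgG : ∀ t a b, g (t, b) - g (t, a) = G (t, a, b) * (b - a)) {γ η : ℝ → ℝ}
    (hγ : ∀ t, HasDerivAt γ (g (t, γ t)) t) (hη : ∀ t, HasDerivAt η (g (t, η t)) t) (t : ℝ) :
    η t - γ t = (η 0 - γ 0) * Real.exp (∫ s in (0 : ℝ)..t, G (s, γ s, η s)) := by
  have cγ : Continuous γ := continuous_iff_continuousAt.2 fun t => (hγ t).continuousAt
  have cη : Continuous η := continuous_iff_continuousAt.2 fun t => (hη t).continuousAt
  have cA : Continuous fun s => G (s, γ s, η s) := by fun_prop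
  set I : ℝ → ℝ := fun t => ∫ s in (0 : ℝ)..t, G (s, γ s, η s) with hI
  have hId (t : ℝ) : HasDerivAt I (G (t, γ t, η t)) t :=
    (cA.integral_hasStrictDerivAt 0 t).hasDerivAt
  -- `exp (-I)` is an integrating factor.
  have hD (t : ℝ) : HasDerivAt (fun t => (η t - γ t) * Real.exp (-I t)) 0 t := by
    convert! ((hη t).sub (hγ t)).mul (hId t).neg.exp using 1
    rw [hgG]; simp; ring
  have := is_const_of_deriv_eq_zero (fun t => (hD t).differentiableAt) (fun t => (hD t).deriv) t 0
  have hI0 : I 0 = 0 := by simp [hI]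
  simp only [hI0, neg_zero, Real.exp_zero, mul_one] at this
  change η t - γ t = (η 0 - γ 0) * Real.exp (I t)
  rw [← this, mul_assoc, ← Real.exp_add]
  simp

/-- Hadamard's lemma in the second variable. -/
theorem exists_continuous_difference_quotient {g g₂ : ℝ × ℝ → ℝ} (hg₂ : Continuous g₂)
    (hd : ∀ p : ℝ × ℝ, HasDerivAt (fun y => g (p.1, y)) (g₂ p) p.2) :
    ∃ G : ℝ × ℝ × ℝ → ℝ, Continuous G ∧
      (∀ t a b, g (t, b) - g (t, a) = G (t, a, b) * (b - a)) ∧ ∀ t a, G (t, a, a) = g₂ (t, a) := by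
  refine ⟨fun q => ∫ θ in (0 : ℝ)..1, g₂ (q.1, q.2.1 + θ * (q.2.2 - q.2.1)), ?_, fun t a b => ?_,
    fun t a => by simp⟩
  · exact intervalIntegral.continuous_parametric_intervalIntegral_of_continuous'
      (f := fun q : ℝ × ℝ × ℝ => fun θ => g₂ (q.1, q.2.1 + θ * (q.2.2 - q.2.1)))
      (by fun_prop) 0 1
  · have hderiv (θ : ℝ) : HasDerivAt (fun θ => g (t, a + θ * (b - a)))
        (g₂ (t, a + θ * (b - a)) * (b - a)) θ := by
      have h1 : HasDerivAt (fun θ : ℝ => a + θ * (b - a)) (b - a) θ := by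
        simpa using ((hasDerivAt_id θ).mul_const (b - a)).const_add a
      exact (hd (t, a + θ * (b - a))).comp θ h1
    have := intervalIntegral.integral_eq_sub_of_hasDerivAt (a := (0 : ℝ)) (b := 1)
      (fun θ _ => hderiv θ) ((by fun_prop : Continuous fun θ : ℝ =>
        g₂ (t, a + θ * (b - a)) * (b - a)).intervalIntegrable _ _)
    simp only [intervalIntegral.integral_mul_const] at this
    simpa using this.symm

/-- The flow of `y' = g(t, y)` is smooth: its vertical derivative is the exponential of the
integral of `∂g/∂y` along the flow, so each degree of smoothness of the flow yields the next. -/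
theorem exists_contDiff_flow {g : ℝ × ℝ → ℝ} (hg : ContDiff ℝ ∞ g) {K L : NNReal}
    (hK : ∀ t, LipschitzWith K fun y => g (t, y)) (hL : ∀ p, ‖g p‖ ≤ L) :
    ∃ Φ : ℝ × ℝ → ℝ, ContDiff ℝ ∞ Φ ∧ (∀ y, Φ (0, y) = y) ∧
      ∀ p : ℝ × ℝ, HasDerivAt (fun t => Φ (t, p.2)) (g (p.1, Φ p)) p.1 := by
  choose γ hγ0 hγ using exists_global_solution hg.continuous hK hL
  obtain ⟨g₂, hg₂, hd⟩ := hg.exists_hasDerivAt_snd (m := ∞) (by simp)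
  obtain ⟨G, hG, hgG, hGd⟩ := exists_continuous_difference_quotient hg₂.continuous hd
  have hdiff (y z t : ℝ) : γ z t - γ y t =
      (z - y) * Real.exp (∫ s in (0 : ℝ)..t, G (s, γ y s, γ z s)) := by
    rw [solution_sub_eq_mul_exp hG hgG (hγ y) (hγ z) t, hγ0, hγ0]
  have hg₂K (p : ℝ × ℝ) : ‖g₂ p‖ ≤ K := by
    rw [← (hd p).deriv]; exact norm_deriv_le_of_lipschitz (hK p.1)
  have hγt (y : ℝ) : LipschitzWith L (γ y) := by
    refine lipschitzWith_of_nnnorm_deriv_le (fun t => (hγ y t).differentiableAt) fun t => ?_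
    rw [(hγ y t).deriv]; exact hL _
  have hGK (t a b : ℝ) : ‖G (t, a, b)‖ ≤ K := by
    rcases eq_or_ne a b with rfl | hab
    · rw [hGd]; exact hg₂K _
    · have := (hK t).dist_le_mul b a
      rw [Real.dist_eq, Real.dist_eq, hgG, abs_mul] at this
      exact le_of_mul_le_mul_right this (abs_pos.2 (sub_ne_zero.2 hab.symm))
  have hcy (t : ℝ) : Continuous fun y => γ y t := by
    refine (LipschitzWith.of_dist_le_mul (K := (Real.exp (K * |t|)).toNNReal)
      fun z y => ?_).continuous
    rw [Real.dist_eq, Real.dist_eq, hdiff, abs_mul, mul_comm, Real.abs_exp,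
      Real.coe_toNNReal _ (Real.exp_pos _).le]
    gcongr
    have := intervalIntegral.norm_integral_le_of_norm_le_const (a := 0) (b := t)
      fun s _ => hGK s (γ y s) (γ z s)
    rw [sub_zero] at this
    exact (le_abs_self _).trans this
  have hcont : Continuous fun p : ℝ × ℝ => γ p.2 p.1 :=
    (continuous_prod_of_continuous_lipschitzWith' (fun q : ℝ × ℝ => γ q.1 q.2) L hγt hcy).comp
      continuous_swap
  have hy (p : ℝ × ℝ) : HasDerivAt (fun y => γ y p.1)
      (Real.exp (∫ s in (0 : ℝ)..p.1, g₂ (s, γ p.2 s))) p.2 := by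
    have hc : Continuous fun z => Real.exp (∫ s in (0 : ℝ)..p.1, G (s, γ p.2 s, γ z s)) := by
      refine Real.continuous_exp.comp
        (intervalIntegral.continuous_parametric_intervalIntegral_of_continuous'
          (f := fun z : ℝ => fun s => G (s, γ p.2 s, γ z s)) ?_ 0 p.1)
      have h1 : Continuous fun q : ℝ × ℝ => γ q.1 q.2 := hcont.comp continuous_swap
      have h2 : Continuous fun q : ℝ × ℝ => γ p.2 q.2 := (hγt p.2).continuous.comp continuous_snd
      exact hG.comp (continuous_snd.prodMk (h2.prodMk h1))
    rw [hasDerivAt_iff_tendsto_slope]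
    have := hc.tendsto p.2
    simp only [hGd] at this
    refine (this.mono_left nhdsWithin_le_nhds).congr' ?_
    filter_upwards [self_mem_nhdsWithin] with z hz
    rw [slope_def_field, hdiff, mul_div_cancel_left₀ _ (sub_ne_zero.2 hz)]
  refine ⟨fun p => γ p.2 p.1, contDiff_infty.2 fun n => ?_, hγ0, fun p => hγ p.2 p.1⟩
  induction n with
  | zero => exact contDiff_zero.2 hcont
  | succ n ih =>
    have hpair : ContDiff ℝ n fun p : ℝ × ℝ => (p.1, γ p.2 p.1) := contDiff_fst.prodMk ih
    refine contDiff_succ_of_hasDerivAt_partials (fun p => hγ p.2 p.1) hy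
      ((hg.of_le (mod_cast le_top)).comp hpair) (Real.contDiff_exp.comp ?_)
    exact ContDiff.intervalIntegral_fst (h := fun p : ℝ × ℝ => g₂ (p.1, γ p.2 p.1))
      ((hg₂.of_le (mod_cast le_top)).comp hpair)

/-! ### Localization and local diffeomorphisms -/

theorem exists_contDiff_hasCompactSupport_eventuallyEq {E : Type*} [NormedAddCommGroup E]
    [NormedSpace ℝ E] [FiniteDimensional ℝ E] {f : E → ℝ} {W : Set E} (hW : IsOpen W)
    (hf : ContDiffOn ℝ ∞ f W) {q : E} (hq : q ∈ W) :
    ∃ g : E → ℝ, ContDiff ℝ ∞ g ∧ HasCompactSupport g ∧ g =ᶠ[nhds q] f := by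
  obtain ⟨r, hr, hrW⟩ := Metric.nhds_basis_closedBall.mem_iff.1 (hW.mem_nhds hq)
  let χ : ContDiffBump q := ⟨r / 2, r, by positivity, by linarith⟩
  refine ⟨fun x => χ x * f x, contDiff_iff_contDiffAt.2 fun x => ?_,
    χ.hasCompactSupport.mul_right, ?_⟩
  · by_cases hx : x ∈ W
    · exact χ.contDiffAt.mul (hf.contDiffAt (hW.mem_nhds hx))
    · have hx' : x ∉ tsupport χ := fun h => hx (hrW (by rwa [χ.tsupport_eq] at h))
      refine (contDiffAt_const (c := (0 : ℝ))).congr_of_eventuallyEq ?_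
      filter_upwards [notMem_tsupport_iff_eventuallyEq.1 hx'] with y hy
      simp [hy]
  · filter_upwards [χ.eventuallyEq_one] with y hy
    simp [hy]

/-- The inverse function theorem, with both the map and its inverse smooth on their domains. -/
theorem exists_openPartialHomeomorph_of_fderiv_injective {E : Type*} [NormedAddCommGroup E]
    [NormedSpace ℝ E] [FiniteDimensional ℝ E] {Y : E → E} {W : Set E} (hW : IsOpen W)
    (hY : ContDiffOn ℝ ∞ Y W) {q : E} (hq : q ∈ W) (hinj : ∀ v, fderiv ℝ Y q v = 0 → v = 0) :
    ∃ e : OpenPartialHomeomorph E E, q ∈ e.source ∧ e.source ⊆ W ∧ (⇑e = Y) ∧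
      ContDiffOn ℝ ∞ e.symm e.target := by
  have : CompleteSpace E := FiniteDimensional.complete ℝ E
  have hYat {x : E} (hx : x ∈ W) : ContDiffAt ℝ ∞ Y x := hY.contDiffAt (hW.mem_nhds hx)
  have hd {x : E} (hx : x ∈ W) (hdet : (fderiv ℝ Y x).det ≠ 0) : HasFDerivAt Y
      ((fderiv ℝ Y x).toContinuousLinearEquivOfDetNeZero hdet : E →L[ℝ] E) x := by
    simpa using ((hYat hx).differentiableAt (by simp)).hasFDerivAt
  have hdet : (fderiv ℝ Y q).det ≠ 0 := fun h => by
    obtain ⟨v, hv, hv0⟩ := Submodule.exists_mem_ne_zero_of_ne_bot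
      (LinearMap.bot_lt_ker_of_det_eq_zero h).ne'
    exact hv0 (hinj v hv)
  have hcont : ContinuousOn (fun x => (fderiv ℝ Y x).det) W :=
    ContinuousLinearMap.continuous_det.comp_continuousOn
      (hY.continuousOn_fderiv_of_isOpen hW (by simp))
  have hopen : IsOpen (W ∩ (fun x => (fderiv ℝ Y x).det) ⁻¹' {0}ᶜ) :=
    hcont.isOpen_inter_preimage hW isOpen_compl_singleton
  let e := (hYat hq).toOpenPartialHomeomorph Y (hd hq hdet) (by simp)
  refine ⟨e.restrOpen _ hopen, ?_, ?_, rfl, ?_⟩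
  · exact ⟨(hYat hq).mem_toOpenPartialHomeomorph_source (hd hq hdet) (by simp), hq, hdet⟩
  · exact fun x hx => hx.2.1
  · intro x hx
    have hx' := (e.restrOpen _ hopen).map_target hx
    exact (OpenPartialHomeomorph.contDiffAt_symm _ hx (hd hx'.2.1 hx'.2.2)
      (hYat hx'.2.1)).contDiffWithinAt

/-! ### First integrals of planar vector fields -/

/-- The integral curves of `V` are graphs of solutions of `y' = g(t, y)`, where `g` is the slope
of `V`, and the first integral assigns to a point the initial value of the solution through it. -/
theorem exists_first_integral_of_fst_ne_zero {V : ℝ × ℝ → ℝ × ℝ} {W : Set (ℝ × ℝ)} (hW : IsOpen W)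
    (hV : ContDiffOn ℝ ∞ V W) {q : ℝ × ℝ} (hq : q ∈ W) (hVq : (V q).1 ≠ 0) :
    ∃ (u : ℝ × ℝ → ℝ) (W' : Set (ℝ × ℝ)), IsOpen W' ∧ q ∈ W' ∧ ContDiffOn ℝ ∞ u W' ∧
      fderiv ℝ u q ≠ 0 ∧ ∀ x ∈ W', fderiv ℝ u x (V x) = 0 := by
  have hWo : IsOpen (W ∩ (fun x => (V x).1) ⁻¹' {0}ᶜ) :=
    (continuous_fst.comp_continuousOn hV.continuousOn).isOpen_inter_preimage hW
      isOpen_compl_singleton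
  have hslope : ContDiffOn ℝ ∞ (fun x => (V x).2 / (V x).1) (W ∩ (fun x => (V x).1) ⁻¹' {0}ᶜ) :=
    (contDiff_snd.comp_contDiffOn (hV.mono Set.inter_subset_left)).div
      (contDiff_fst.comp_contDiffOn (hV.mono Set.inter_subset_left)) fun x hx => hx.2
  -- A cutoff makes the slope globally defined, bounded and Lipschitz without changing it near `q`.
  obtain ⟨g, hg, hgc, hgV⟩ := exists_contDiff_hasCompactSupport_eventuallyEq hWo hslope
    (q := q) ⟨hq, hVq⟩
  obtain ⟨K, hK⟩ := hg.lipschitzWith_of_hasCompactSupport hgc (by simp)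
  obtain ⟨B, hB⟩ := hgc.exists_bound_of_continuous hg.continuous
  -- Time is shifted so that the solutions start on the vertical line through `q`.
  obtain ⟨Φ, hΦ, hΦ0, hΦd⟩ := exists_contDiff_flow (g := fun p => g (q.1 + p.1, p.2))
    (K := K) (L := B.toNNReal) (by fun_prop)
    (fun t => LipschitzWith.of_dist_le_mul fun y z => by
      simpa [Prod.dist_eq] using hK.dist_le_mul (q.1 + t, y) (q.1 + t, z))
    (fun p => (hB _).trans (Real.le_coe_toNNReal B))
  let Ψ : ℝ × ℝ → ℝ × ℝ := fun p => (q.1 + p.1, Φ p)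
  have hΨ : ContDiff ℝ ∞ Ψ := by fun_prop
  have hΨq : Ψ (0, q.2) = q := by simp [Ψ, hΦ0]
  have hΦdiff (p : ℝ × ℝ) : HasFDerivAt Φ (fderiv ℝ Φ p) p :=
    (hΦ.differentiable (by simp)).differentiableAt.hasFDerivAt
  have hΨd (p : ℝ × ℝ) :
      HasFDerivAt Ψ ((ContinuousLinearMap.fst ℝ ℝ ℝ).prod (fderiv ℝ Φ p)) p :=
    (hasFDerivAt_fst.const_add _).prodMk (hΦdiff p)
  have hΦ1 (p : ℝ × ℝ) : fderiv ℝ Φ p (1, 0) = g (Ψ p) := by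
    have h2 : HasDerivAt (fun t : ℝ => (t, p.2)) ((1 : ℝ), (0 : ℝ)) p.1 :=
      (hasDerivAt_id _).prodMk (hasDerivAt_const _ _)
    exact ((hΦdiff p).comp_hasDerivAt_of_eq p.1 h2 rfl).unique (hΦd p)
  have hΦ2 : fderiv ℝ Φ (0, q.2) (0, 1) = 1 := by
    have h2 : HasDerivAt (fun y : ℝ => ((0 : ℝ), y)) ((0 : ℝ), (1 : ℝ)) q.2 :=
      (hasDerivAt_const _ _).prodMk (hasDerivAt_id _)
    refine ((hΦdiff (0, q.2)).comp_hasDerivAt_of_eq q.2 h2 rfl).unique ?_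
    exact (hasDerivAt_id q.2).congr_of_eventuallyEq (.of_forall fun y => hΦ0 y)
  obtain ⟨e, hqe, -, heΨ, hes⟩ := exists_openPartialHomeomorph_of_fderiv_injective isOpen_univ
    hΨ.contDiffOn (q := (0, q.2)) trivial (by
      rintro ⟨v, w⟩ h
      rw [(hΨd _).fderiv] at h
      simp only [ContinuousLinearMap.prod_apply, Prod.mk_eq_zero,
        ContinuousLinearMap.coe_fst'] at h
      obtain ⟨rfl, h⟩ := h
      have : ((0 : ℝ), w) = w • ((0 : ℝ), (1 : ℝ)) := by simp
      rw [this, map_smul, hΦ2] at h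
      simpa using h)
  have hq' : q ∈ e.target := by
    have := e.map_source hqe
    rwa [heΨ, hΨq] at this
  have heq : e.symm q = (0, q.2) := by
    have := e.left_inv hqe
    rwa [heΨ, hΨq] at this
  let u : ℝ × ℝ → ℝ := fun x => (e.symm x).2
  have hu : ContDiffOn ℝ ∞ u e.target := contDiff_snd.comp_contDiffOn hes
  -- The chain rule for `u ∘ Ψ = Prod.snd`.
  have hud {x : ℝ × ℝ} (hx : x ∈ e.target) (v : ℝ × ℝ) :
      fderiv ℝ u x (v.1, fderiv ℝ Φ (e.symm x) v) = v.2 := by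
    have hxs := e.map_target hx
    have hux : HasFDerivAt u (fderiv ℝ u x) x := ((hu.contDiffAt (e.open_target.mem_nhds
      hx)).differentiableAt (by simp)).hasFDerivAt
    have hΨx : Ψ (e.symm x) = x := by rw [← heΨ, e.right_inv hx]
    have hcomp := HasFDerivAt.comp (e.symm x) (by rwa [hΨx]) (hΨd (e.symm x))
    have h3 : HasFDerivAt (u ∘ Ψ) (ContinuousLinearMap.snd ℝ ℝ ℝ) (e.symm x) := by
      refine hasFDerivAt_snd.congr_of_eventuallyEq ?_
      filter_upwards [e.open_source.mem_nhds hxs] with p hp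
      simp [u, ← heΨ, e.left_inv hp]
    exact congrArg (fun T : ℝ × ℝ →L[ℝ] ℝ => T v) (hcomp.unique h3)
  obtain ⟨O, hO, hOo, hqO⟩ := mem_nhds_iff.1 (hgV.and (hWo.mem_nhds ⟨hq, hVq⟩))
  refine ⟨u, O ∩ e.target, hOo.inter e.open_target, ⟨hqO, hq'⟩, hu.mono Set.inter_subset_right,
    fun h => ?_, fun x hx => ?_⟩
  · have := hud hq' (0, 1)
    simp [h] at this
  · obtain ⟨hgx, -, hx0⟩ := hO hx.1
    have hx0 : (V x).1 ≠ 0 := hx0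
    have := hud hx.2 (1, 0)
    rw [hΦ1, ← heΨ, e.right_inv hx.2, hgx] at this
    have hVx : V x = (V x).1 • ((1 : ℝ), (V x).2 / (V x).1) := by
      ext <;> simp [mul_div_cancel₀, hx0]
    rw [hVx, map_smul, this, smul_zero]

/-- A nonvanishing smooth planar vector field has, locally, a smooth first integral with nonzero
differential. -/
theorem exists_first_integral {V : Plane → Plane} {W : Set Plane} (hW : IsOpen W)
    (hV : ContDiffOn ℝ ∞ V W) {q : Plane} (hq : q ∈ W) (hVq : V q ≠ 0) :
    ∃ (u : Plane → ℝ) (W' : Set Plane), IsOpen W' ∧ q ∈ W' ∧ ContDiffOn ℝ ∞ u W' ∧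
      fderiv ℝ u q ≠ 0 ∧ ∀ x ∈ W', fderiv ℝ u x (V x) = 0 := by
  obtain ⟨T, hT⟩ : ∃ T : Plane ≃L[ℝ] ℝ × ℝ, (T (V q)).1 ≠ 0 := by
    let T := (EuclideanSpace.equiv (Fin 2) ℝ).trans (ContinuousLinearEquiv.finTwoArrow ℝ ℝ)
    by_cases h : (T (V q)).1 = 0
    · refine ⟨T.trans (ContinuousLinearEquiv.prodComm ℝ ℝ ℝ), fun h' => hVq (T.injective ?_)⟩
      rw [map_zero]
      exact Prod.ext h h'
    · exact ⟨T, h⟩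
  obtain ⟨u, W', hW', hqW', hu, huq, huV⟩ := exists_first_integral_of_fst_ne_zero
    (V := fun x => T (V (T.symm x))) (W := T.symm ⁻¹' W) (q := T q)
    (hW.preimage T.symm.continuous)
    (T.contDiff.comp_contDiffOn (hV.comp T.symm.contDiff.contDiffOn fun x hx => hx))
    (by simpa using hq) (by simpa using hT)
  have hd (x : Plane) : fderiv ℝ (u ∘ T) x = (fderiv ℝ u (T x)).comp (T : Plane →L[ℝ] ℝ × ℝ) :=
    T.comp_right_fderiv
  refine ⟨u ∘ T, T ⁻¹' W', hW'.preimage T.continuous, hqW',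
    hu.comp T.contDiff.contDiffOn fun x hx => hx, fun h => huq ?_, fun x hx => ?_⟩
  · rw [hd] at h
    refine ContinuousLinearMap.ext fun v => ?_
    simpa using congrArg (fun A : Plane →L[ℝ] ℝ => A (T.symm v)) h
  · simpa [hd] using huV (T x) hx

/-! ### Coordinates adapted to two transverse vector fields -/

/-- A covector that vanishes on two vectors with nonzero determinant is zero. -/
theorem clm_eq_zero_of_apply_eq_zero {v w : Plane} (hvw : v 0 * w 1 - w 0 * v 1 ≠ 0)
    {A : Plane →L[ℝ] ℝ} (hv : A v = 0) (hw : A w = 0) : A = 0 := by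
  have hA (z : Plane) :
      A z = z 0 * A (EuclideanSpace.single 0 1) + z 1 * A (EuclideanSpace.single 1 1) := by
    conv_lhs => rw [← (EuclideanSpace.basisFun (Fin 2) ℝ).sum_repr z]
    simp [Fin.sum_univ_two]
  rw [hA] at hv hw
  have h0 : A (EuclideanSpace.single 0 1) = 0 :=
    (mul_eq_zero.1 (by linear_combination w 1 * hv - v 1 * hw :
      (v 0 * w 1 - w 0 * v 1) * A (EuclideanSpace.single 0 1) = 0)).resolve_left hvw
  have h1 : A (EuclideanSpace.single 1 1) = 0 :=
    (mul_eq_zero.1 (by linear_combination v 0 * hw - w 0 * hv :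
      (v 0 * w 1 - w 0 * v 1) * A (EuclideanSpace.single 1 1) = 0)).resolve_left hvw
  refine ContinuousLinearMap.ext fun z => ?_
  rw [hA, h0, h1]; simp

/-- Two transverse vector fields become multiples of the coordinate fields in suitable coordinates.
The first coordinate is a first integral of `V₂`, the second one a first integral of `V₁`. -/
theorem exists_adapted_coordinates {V₁ V₂ : Plane → Plane} {W : Set Plane} (hW : IsOpen W)
    (hV₁ : ContDiffOn ℝ ∞ V₁ W) (hV₂ : ContDiffOn ℝ ∞ V₂ W) {q : Plane} (hq : q ∈ W)
    (hind : V₁ q 0 * V₂ q 1 - V₂ q 0 * V₁ q 1 ≠ 0) :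
    ∃ e : OpenPartialHomeomorph Plane Plane, q ∈ e.source ∧ e.source ⊆ W ∧
      ContDiffOn ℝ ∞ e e.source ∧ ContDiffOn ℝ ∞ e.symm e.target ∧ ∀ x ∈ e.source,
        fderiv ℝ e x (V₁ x) 0 ≠ 0 ∧ fderiv ℝ e x (V₁ x) 1 = 0 ∧
        fderiv ℝ e x (V₂ x) 0 = 0 ∧ fderiv ℝ e x (V₂ x) 1 ≠ 0 := by
  have hV₁q : V₁ q ≠ 0 := fun h => hind (by simp [h])
  have hV₂q : V₂ q ≠ 0 := fun h => hind (by simp [h])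
  obtain ⟨u₁, W₁, hW₁, hqW₁, hu₁, hu₁q, hu₁V⟩ := exists_first_integral hW hV₂ hq hV₂q
  obtain ⟨u₂, W₂, hW₂, hqW₂, hu₂, hu₂q, hu₂V⟩ := exists_first_integral hW hV₁ hq hV₁q
  have hO₁ : IsOpen ((W ∩ W₁) ∩ (fun x => fderiv ℝ u₁ x (V₁ x)) ⁻¹' {0}ᶜ) :=
    (((hu₁.continuousOn_fderiv_of_isOpen hW₁ (by simp)).mono Set.inter_subset_right).clm_apply
      (hV₁.continuousOn.mono Set.inter_subset_left)).isOpen_inter_preimage (hW.inter hW₁)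
      isOpen_compl_singleton
  have hO₂ : IsOpen ((W ∩ W₂) ∩ (fun x => fderiv ℝ u₂ x (V₂ x)) ⁻¹' {0}ᶜ) :=
    (((hu₂.continuousOn_fderiv_of_isOpen hW₂ (by simp)).mono Set.inter_subset_right).clm_apply
      (hV₂.continuousOn.mono Set.inter_subset_left)).isOpen_inter_preimage (hW.inter hW₂)
      isOpen_compl_singleton
  have hq₁ : fderiv ℝ u₁ q (V₁ q) ≠ 0 := fun h =>
    hu₁q (clm_eq_zero_of_apply_eq_zero hind h (hu₁V q hqW₁))
  have hq₂ : fderiv ℝ u₂ q (V₂ q) ≠ 0 := fun h =>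
    hu₂q (clm_eq_zero_of_apply_eq_zero hind (hu₂V q hqW₂) h)
  set O := ((W ∩ W₁) ∩ (fun x => fderiv ℝ u₁ x (V₁ x)) ⁻¹' {0}ᶜ) ∩
    ((W ∩ W₂) ∩ (fun x => fderiv ℝ u₂ x (V₂ x)) ⁻¹' {0}ᶜ) with hO
  have hOo : IsOpen O := hO₁.inter hO₂
  have hqO : q ∈ O := ⟨⟨⟨hq, hqW₁⟩, hq₁⟩, ⟨⟨hq, hqW₂⟩, hq₂⟩⟩
  let Y : Plane → Plane := fun x => !₂[u₁ x, u₂ x]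
  have hY : ContDiffOn ℝ ∞ Y O := by
    rw [contDiffOn_euclidean]
    intro k
    fin_cases k
    · exact hu₁.mono fun x hx => hx.1.1.2
    · exact hu₂.mono fun x hx => hx.2.1.2
  have hYd {x : Plane} (hx : x ∈ O) (v : Plane) :
      fderiv ℝ Y x v 0 = fderiv ℝ u₁ x v ∧ fderiv ℝ Y x v 1 = fderiv ℝ u₂ x v := by
    have h := ((hY.contDiffAt (hOo.mem_nhds hx)).differentiableAt (by simp)).hasFDerivAt
    have hk (k : Fin 2) : HasFDerivAt (fun x => Y x k)
        ((EuclideanSpace.proj k : Plane →L[ℝ] ℝ).comp (fderiv ℝ Y x)) x :=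
      (EuclideanSpace.proj k : Plane →L[ℝ] ℝ).hasFDerivAt.comp x h
    exact ⟨(congrArg (fun A : Plane →L[ℝ] ℝ => A v) (hk 0).fderiv).symm,
      (congrArg (fun A : Plane →L[ℝ] ℝ => A v) (hk 1).fderiv).symm⟩
  obtain ⟨e, hqe, heO, heY, hes⟩ := exists_openPartialHomeomorph_of_fderiv_injective hOo hY hqO
    (fun v hv => by
      have h0 : fderiv ℝ u₁ q v = 0 := by rw [← (hYd hqO v).1, hv]; rfl
      have h1 : fderiv ℝ u₂ q v = 0 := by rw [← (hYd hqO v).2, hv]; rfl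
      by_contra hv0
      -- If `v ≠ 0`, then `v` is independent of `V₁ q` or of `V₂ q`, and one of the differentials
      -- vanishes on two independent vectors.
      by_cases hd₁ : V₁ q 0 * v 1 - v 0 * V₁ q 1 = 0
      · by_cases hd₂ : v 0 * V₂ q 1 - V₂ q 0 * v 1 = 0
        · refine hv0 ?_
          ext k
          fin_cases k
          · exact (mul_eq_zero.1 (by
              linear_combination V₁ q 0 * hd₂ + V₂ q 0 * hd₁ :
              (V₁ q 0 * V₂ q 1 - V₂ q 0 * V₁ q 1) * v 0 = 0)).resolve_left hind
          · exact (mul_eq_zero.1 (by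
              linear_combination V₂ q 1 * hd₁ + V₁ q 1 * hd₂ :
              (V₁ q 0 * V₂ q 1 - V₂ q 0 * V₁ q 1) * v 1 = 0)).resolve_left hind
        · exact hu₁q (clm_eq_zero_of_apply_eq_zero hd₂ h0 (hu₁V q hqW₁))
      · exact hu₂q (clm_eq_zero_of_apply_eq_zero hd₁ (hu₂V q hqW₂) h1))
  refine ⟨e, hqe, fun x hx => (heO hx).1.1.1, heY ▸ hY.mono heO, hes, fun x hx => ?_⟩
  have hxO := heO hx
  rw [heY, (hYd hxO _).1, (hYd hxO _).1, (hYd hxO _).2, (hYd hxO _).2]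
  exact ⟨hxO.1.2, hu₂V x hxO.2.1.2, hu₁V x hxO.1.1.2, hxO.2.2⟩

/-! ### Change of coordinates in the cotangent bundle -/

theorem trans_mem_maximalAtlas {M : Type*} [TopologicalSpace M] [ChartedSpace Plane M]
    [IsManifold (𝓡 2) ∞ M] {φ : OpenPartialHomeomorph M Plane}
    (hφ : φ ∈ IsManifold.maximalAtlas (𝓡 2) ∞ M) {e : OpenPartialHomeomorph Plane Plane}
    (he : ContDiffOn ℝ ∞ e e.source) (hes : ContDiffOn ℝ ∞ e.symm e.target) :
    φ.trans e ∈ IsManifold.maximalAtlas (𝓡 2) ∞ M := by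
  refine (φ.trans e).mem_maximalAtlas_of_contMDiffOn ?_ ?_
  · exact he.contMDiffOn.comp ((contMDiffOn_of_mem_maximalAtlas hφ).mono fun x hx => hx.1)
      fun x hx => hx.2
  · exact (contMDiffOn_symm_of_mem_maximalAtlas hφ).comp (hes.contMDiffOn.mono fun x hx => hx.1)
      fun x hx => hx.2

/-- The momenta transform by the transposed derivative of the change of coordinates. -/
theorem covectorOfMomenta_trans {M : Type*} [TopologicalSpace M] [ChartedSpace Plane M]
    [IsManifold (𝓡 2) ∞ M] {φ : OpenPartialHomeomorph M Plane}
    (hφ : φ ∈ IsManifold.maximalAtlas (𝓡 2) ∞ M) {e : OpenPartialHomeomorph Plane Plane}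
    {x : M} (hx : x ∈ φ.source) (he : DifferentiableAt ℝ e (φ x)) (p : Fin 2 → ℝ) :
    covectorOfMomenta (φ.trans e) x p = covectorOfMomenta φ x fun k =>
      ∑ i, p i * fderiv ℝ e (φ x) (EuclideanSpace.single k 1) i := by
  have hφx : MDifferentiableAt (𝓡 2) (𝓡 2) φ x :=
    (contMDiffAt_of_mem_maximalAtlas hφ hx).mdifferentiableAt (by simp)
  have h := mfderiv_comp x he.mdifferentiableAt hφx
  have hA : (∑ i : Fin 2, p i • (EuclideanSpace.proj i : Plane →L[ℝ] ℝ)).comp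
      (fderiv ℝ e (φ x)) = ∑ k : Fin 2, (∑ i, p i * fderiv ℝ e (φ x)
        (EuclideanSpace.single k 1) i) • (EuclideanSpace.proj k : Plane →L[ℝ] ℝ) := by
    refine ContinuousLinearMap.ext fun z => ?_
    conv_lhs => rw [← (EuclideanSpace.basisFun (Fin 2) ℝ).sum_repr z]
    simp [Fin.sum_univ_two]
    ring
  unfold covectorOfMomenta
  rw [OpenPartialHomeomorph.coe_trans, h, mfderiv_eq_fderiv, ← hA]
  rfl

/-! ### The normal form -/

/-- A product over `Fin N` with two of its factors singled out. -/
theorem exists_prod_eq_mul_mul_prod {N : ℕ} {i j : Fin N} (hij : i ≠ j) :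
    ∃ σ : Fin (N - 2) → Fin N, ∀ F : Fin N → ℝ, ∏ m, F m = F i * F j * ∏ k, F (σ k) := by
  have hj : j ∈ Finset.univ.erase i := by simp [hij.symm]
  have hs : ((Finset.univ.erase i).erase j).card = N - 2 := by
    rw [Finset.card_erase_of_mem hj, Finset.card_erase_of_mem (Finset.mem_univ i)]
    simp; omega
  let τ := Finset.equivFinOfCardEq hs
  refine ⟨fun k => (τ.symm k : Fin N), fun F => ?_⟩
  rw [← Finset.mul_prod_erase _ _ (Finset.mem_univ i), ← Finset.mul_prod_erase _ _ hj, mul_assoc,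
    Equiv.prod_comp τ.symm fun m => F m, Finset.prod_coe_sort]

theorem mainTheorem1 {M : Type*} [TopologicalSpace M] [ChartedSpace Plane M]
    [IsManifold (𝓡 2) ∞ M] (N : ℕ) (f : (x : M) → CotangentAt x → ℝ) (P : M)
    (φ : OpenPartialHomeomorph M Plane) (hφ : φ ∈ IsManifold.maximalAtlas (𝓡 2) ∞ M)
    (hP : P ∈ φ.source) (α : Fin N → Fin 2 → Plane → ℝ)
    (hα : ∀ m k, ContDiffOn ℝ ∞ (α m k) φ.target)
    (hf : HasExpression f φ (fun x p => ∏ m, (α m 0 x * p 0 + α m 1 x * p 1)))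
    (i j : Fin N)
    (hij : α i 0 (φ P) * α j 1 (φ P) - α j 0 (φ P) * α i 1 (φ P) ≠ 0) :
    ∃ ψ ∈ IsManifold.maximalAtlas (𝓡 2) ∞ M, P ∈ ψ.source ∧
      (3 ≤ N → ∃ β : Fin (N - 2) → Fin 2 → Plane → ℝ,
        (∀ m k, ContDiffOn ℝ ∞ (β m k) ψ.target) ∧
        HasExpression f ψ
          (fun x p => p 0 * p 1 * ∏ m, (β m 0 x * p 0 + β m 1 x * p 1))) ∧
      (N = 2 → ∃ c : Plane → ℝ,
        ContDiffOn ℝ ∞ c ψ.target ∧ (∀ x ∈ ψ.target, c x ≠ 0) ∧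
        HasExpression f ψ (fun x p => c x * (p 0 * p 1))) := by
  let V : Fin N → Plane → Plane := fun m x => !₂[α m 0 x, α m 1 x]
  have hV (m : Fin N) : ContDiffOn ℝ ∞ (V m) φ.target := by
    rw [contDiffOn_euclidean]
    intro k
    fin_cases k
    · exact hα m 0
    · exact hα m 1
  obtain ⟨e, hPe, heφ, he, hes, heV⟩ := exists_adapted_coordinates φ.open_target (hV i) (hV j)
    (φ.map_source hP) hij
  have hed {x : Plane} (hx : x ∈ e.source) : DifferentiableAt ℝ e x :=
    (he.contDiffAt (e.open_source.mem_nhds hx)).differentiableAt (by simp)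
  -- The components of the vector field `V m` in the new coordinates.
  let γ : Fin N → Fin 2 → Plane → ℝ := fun m k y => fderiv ℝ e (e.symm y) (V m (e.symm y)) k
  have hγ (m : Fin N) (k : Fin 2) : ContDiffOn ℝ ∞ (γ m k) e.target := by
    have h : ContDiffOn ℝ ∞ (fun x => fderiv ℝ e x (V m x)) e.source :=
      (he.fderiv_of_isOpen e.open_source (by simp)).clm_apply ((hV m).mono heφ)
    exact (contDiffOn_euclidean.1 h k).comp hes fun y hy => e.map_target hy
  have htarget : (φ.trans e).target ⊆ e.target := fun y hy => hy.1
  have hexp : HasExpression f (φ.trans e) fun y p => ∏ m, (γ m 0 y * p 0 + γ m 1 y * p 1) := by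
    intro x hx p
    rw [covectorOfMomenta_trans hφ hx.1 (hed hx.2), hf x hx.1]
    refine Finset.prod_congr rfl fun m _ => ?_
    have hsymm : e.symm ((φ.trans e) x) = φ x := e.left_inv hx.2
    simp only [γ, hsymm]
    have hVm : V m (φ x) = α m 0 (φ x) • EuclideanSpace.single 0 1 +
        α m 1 (φ x) • EuclideanSpace.single 1 1 := by
      ext k; fin_cases k <;> simp [V]
    rw [hVm]
    simp [Fin.sum_univ_two]
    ring
  obtain ⟨σ, hσ⟩ := exists_prod_eq_mul_mul_prod (i := i) (j := j)
    (by rintro rfl; exact hij (sub_self _))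
  let c : Plane → ℝ := fun y => γ i 0 y * γ j 1 y
  have hc : ContDiffOn ℝ ∞ c (φ.trans e).target := ((hγ i 0).mul (hγ j 1)).mono htarget
  have hexp' : HasExpression f (φ.trans e) fun y p =>
      c y * (p 0 * p 1) * ∏ k, (γ (σ k) 0 y * p 0 + γ (σ k) 1 y * p 1) := by
    intro x hx p
    have hy := heV _ (e.map_target (e.map_source hx.2))
    have hi : γ i 1 ((φ.trans e) x) = 0 := hy.2.1
    have hj : γ j 0 ((φ.trans e) x) = 0 := hy.2.2.1
    rw [hexp x hx]
    refine (hσ _).trans ?_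
    simp only [c, hi, hj]
    ring
  refine ⟨φ.trans e, trans_mem_maximalAtlas hφ he hes, ⟨hP, hPe⟩, fun hN => ?_, fun hN => ?_⟩
  · -- The scalar factor `c` is absorbed into the first of the remaining linear factors.
    let k₀ : Fin (N - 2) := ⟨0, by omega⟩
    refine ⟨fun m k y => (if m = k₀ then c y else 1) * γ (σ m) k y, fun m k => ?_,
      fun x hx p => ?_⟩
    · refine ContDiffOn.mul ?_ ((hγ (σ m) k).mono htarget)
      split_ifs
      exacts [hc, contDiffOn_const]
    · rw [hexp' x hx]
      simp only [mul_assoc, ← mul_add, Finset.prod_mul_distrib]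
      simp
      ring
  · subst hN
    refine ⟨c, hc, fun y hy => ?_, fun x hx p => ?_⟩
    · have := heV _ (e.map_target (htarget hy))
      exact mul_ne_zero this.1 this.2.2.2
    · rw [hexp' x hx]
      simp
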